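/- There is an absolute constant $C>0$ such that, for every integer $n\ge 1$, every family $\mathcal{F}$ of subsets of $[n]=\{1,\dots,n\}$ with $|\mathcal{F}|\ge Cn^2$ contains three sets $X,Y,Z\in\mathcal{F}$ such that at least six of the seven inner regions of their 3-Venn diagram are non-empty. Here, writing $\overline{S}=[n]\setminus S$, the inner regions are all the regions other than $\overline{X}\cap\overline{Y}\cap\overline{Z}$, that is, $X\cap Y\cap Z$, $\overline{X}\cap Y\cap Z$, $X\cap\overline{Y}\cap Z$, $X\cap Y\cap\overline{Z}$, $X\cap\overline{Y}\cap\overline{Z}$, $\overline{X}\cap Y\cap\overline{Z}$ and $\overline{X}\cap\overline{Y}\cap Z$. -/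

import Mathlib

/-- The seven inner regions of the 3-Venn diagram of `X`, `Y`, `Z`, as a multiset (so that empty
regions are listed with multiplicity): all regions except `Xᶜ ∩ Yᶜ ∩ Zᶜ`. -/
def innerRegions {n : ℕ} (X Y Z : Finset (Fin n)) : Multiset (Finset (Fin n)) :=
  {X ∩ Y ∩ Z,
   Xᶜ ∩ Y ∩ Z, X ∩ Yᶜ ∩ Z, X ∩ Y ∩ Zᶜ,
   X ∩ Yᶜ ∩ Zᶜ, Xᶜ ∩ Y ∩ Zᶜ, Xᶜ ∩ Yᶜ ∩ Z}

/-- The number of inner regions of the 3-Venn diagram of `X`, `Y`, `Z` that are non-empty. -/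
def filledInnerRegions {n : ℕ} (X Y Z : Finset (Fin n)) : ℕ :=
  (innerRegions X Y Z).countP (fun R => R.Nonempty)

/-! Call a family k-free if no three members fill more than k inner regions. A member of `edgeFamily
F p` may take or leave `p`, so `p` can be steered into an empty region: edge families of a 5-free
family are 4-free, and edge families of a 4-free family are 3-free, hence laminar once they have
more than eight members. Erasing `p` loses at most `(edgeFamily F p).card` sets, so by induction a
family just above `60 n ^ 2 + 1` has all edge families of size about `120 n`. Yet their sizes sum to
at most `F.card + O(n ^ 2)`: sets in a single edge family are counted once, and
`VennFree.card_edgeFamily_repeated_le` bounds the others. For that bound, too many repeated sets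
would have a trace whose edge families all exceed 20. Laminarity yields a set `S` with five disjoint
petals inside it at each of its points (`VennFree.exists_disjoint_stars`). A smallest petal is a
singleton, so some repeated `A` has trace `{q, r}`. Its second extension point `z`, with petals at
`q` and `r`, fills six regions (`VennFree.false_of_star`, `VennFree.false_of_path`). -/

namespace VennFamily

variable {α : Type*} [DecidableEq α]

/-! ### Venn patterns, traces and edge families -/

/-- The membership patterns, other than the all-false one, realised by the points of the
3-Venn diagram of `X`, `Y`, `Z`. -/
def venn (X Y Z : Finset α) : Finset (Bool × Bool × Bool) :=
  (X ∪ Y ∪ Z).image fun a => (decide (a ∈ X), decide (a ∈ Y), decide (a ∈ Z))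

/-- No three members of `F` fill more than `k` inner regions. -/
def VennFree (k : ℕ) (F : Finset (Finset α)) : Prop :=
  ∀ X ∈ F, ∀ Y ∈ F, ∀ Z ∈ F, (venn X Y Z).card ≤ k

/-- The sets `A ∈ F` avoiding `p` such that `A ∪ {p} ∈ F`. -/
def edgeFamily (F : Finset (Finset α)) (p : α) : Finset (Finset α) :=
  F.filter fun A => p ∉ A ∧ insert p A ∈ F

/-- The trace of `F` on `U`. -/
def trace (F : Finset (Finset α)) (U : Finset α) : Finset (Finset α) :=
  F.image (· ∩ U)

theorem mem_edgeFamily {F : Finset (Finset α)} {p : α} {A : Finset α} :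
    A ∈ edgeFamily F p ↔ A ∈ F ∧ p ∉ A ∧ insert p A ∈ F := by
  simp [edgeFamily]

theorem mem_trace {F : Finset (Finset α)} {U A : Finset α} :
    A ∈ trace F U ↔ ∃ B ∈ F, B ∩ U = A := by
  simp [trace]

theorem mem_venn {X Y Z : Finset α} {x y z : Bool} :
    (x, y, z) ∈ venn X Y Z ↔
      (x || y || z) = true ∧ ∃ a, (a ∈ X ↔ x) ∧ (a ∈ Y ↔ y) ∧ (a ∈ Z ↔ z) := by
  simp only [venn, Finset.mem_image, Finset.mem_union, Prod.mk.injEq]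
  constructor
  · rintro ⟨a, h, rfl, rfl, rfl⟩
    refine ⟨?_, a, ?_⟩ <;> simp
    tauto
  · rintro ⟨h, a, h1, h2, h3⟩
    refine ⟨a, ?_, ?_⟩
    · cases x <;> cases y <;> cases z <;> simp_all
    · cases x <;> cases y <;> cases z <;> simp_all

theorem mem_venn_of {X Y Z : Finset α} (x y z : Bool) (a : α)
    (h1 : a ∈ X ↔ x) (h2 : a ∈ Y ↔ y) (h3 : a ∈ Z ↔ z)
    (h : (x || y || z) = true := by rfl) :
    (x, y, z) ∈ venn X Y Z :=
  mem_venn.2 ⟨h, a, h1, h2, h3⟩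

/-- Points outside `U` fall into the all-false pattern, which `venn` omits; hence freeness passes to
traces. -/
theorem venn_inter_subset (X Y Z U : Finset α) :
    venn (X ∩ U) (Y ∩ U) (Z ∩ U) ⊆ venn X Y Z := by
  rintro ⟨x, y, z⟩ h
  obtain ⟨h, a, h1, h2, h3⟩ := mem_venn.1 h
  have ha : a ∈ U := by
    by_contra ha
    cases x <;> cases y <;> cases z <;> simp_all
  simp only [Finset.mem_inter, ha, and_true] at h1 h2 h3
  exact mem_venn.2 ⟨h, a, h1, h2, h3⟩

theorem VennFree.mono {k : ℕ} {F G : Finset (Finset α)} (h : VennFree k F) (hG : G ⊆ F) :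
    VennFree k G :=
  fun X hX Y hY Z hZ => h X (hG hX) Y (hG hY) Z (hG hZ)

theorem vennFree_trace {k : ℕ} {F : Finset (Finset α)} (h : VennFree k F) (U : Finset α) :
    VennFree k (trace F U) := by
  intro X hX Y hY Z hZ
  obtain ⟨A, hA, rfl⟩ := mem_trace.1 hX
  obtain ⟨B, hB, rfl⟩ := mem_trace.1 hY
  obtain ⟨C, hC, rfl⟩ := mem_trace.1 hZ
  exact (Finset.card_le_card (venn_inter_subset A B C U)).trans (h A hA B hB C hC)

theorem card_le_filledInnerRegions {n : ℕ} (X Y Z : Finset (Fin n)) :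
    (venn X Y Z).card ≤ filledInnerRegions X Y Z := by
  have h : venn X Y Z = Finset.univ.filter (fun t => t ∈ venn X Y Z) := by ext; simp
  rw [h, Finset.card_filter]
  simp only [Fintype.sum_prod_type, Fintype.sum_bool]
  simp only [filledInnerRegions, innerRegions, Multiset.insert_eq_cons]
  rw [← Multiset.cons_zero]
  simp only [Multiset.countP_cons, Multiset.countP_zero]
  simp only [mem_venn, Finset.Nonempty, Finset.mem_inter, Finset.mem_compl]
  simp [and_assoc]
  omega

/-- Adding `p` to a suitable choice of the three sets puts it in any prescribed empty inner region
without disturbing the others. The bound on `k` guarantees that one of the seven is empty. -/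
theorem vennFree_edgeFamily {k : ℕ} {F : Finset (Finset α)} (h : VennFree (k + 1) F) (hk : k < 6)
    (p : α) : VennFree k (edgeFamily F p) := by
  intro X hX Y hY Z hZ
  obtain ⟨hX, hpX, hX'⟩ := mem_edgeFamily.1 hX
  obtain ⟨hY, hpY, hY'⟩ := mem_edgeFamily.1 hY
  obtain ⟨hZ, hpZ, hZ'⟩ := mem_edgeFamily.1 hZ
  by_contra hc
  have h7 := h X hX Y hY Z hZ
  obtain ⟨⟨x, y, z⟩, ht⟩ : ∃ t, t ∉ insert (false, false, false) (venn X Y Z) := by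
    by_contra! hall
    have := Finset.card_le_card (fun t _ => hall t :
      (Finset.univ : Finset (Bool × Bool × Bool)) ⊆ _)
    have := Finset.card_insert_le (false, false, false) (venn X Y Z)
    simp only [Finset.card_univ, Fintype.card_prod, Fintype.card_bool] at *
    omega
  simp only [Finset.mem_insert, not_or] at ht
  set f : Bool → Finset α → Finset α := fun b W => if b then insert p W else W with hf
  have hmem : ∀ b W, W ∈ F → insert p W ∈ F → f b W ∈ F := by
    intro b W h1 h2; cases b <;> simp [hf, h1, h2]
  have hp : ∀ b W, p ∉ W → (p ∈ f b W ↔ b = true) := by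
    intro b W h1; cases b <;> simp [hf, h1]
  have hne : ∀ b W a, a ≠ p → (a ∈ f b W ↔ a ∈ W) := by
    intro b W a h1; cases b <;> simp [hf, h1]
  have hsub : insert (x, y, z) (venn X Y Z) ⊆ venn (f x X) (f y Y) (f z Z) := by
    intro t hts
    rcases Finset.mem_insert.1 hts with rfl | hts
    · refine mem_venn.2 ⟨?_, p, hp x X hpX, hp y Y hpY, hp z Z hpZ⟩
      have := ht.1
      cases x <;> cases y <;> cases z <;> simp_all
    · obtain ⟨x', y', z'⟩ := t
      obtain ⟨h0, a, h1, h2, h3⟩ := mem_venn.1 hts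
      have ha : a ≠ p := by
        rintro rfl
        cases x' <;> cases y' <;> cases z' <;> simp_all
      exact mem_venn.2 ⟨h0, a, by rw [hne _ _ _ ha, h1], by rw [hne _ _ _ ha, h2],
        by rw [hne _ _ _ ha, h3]⟩
  have h1 := Finset.card_le_card hsub
  rw [Finset.card_insert_of_notMem ht.2] at h1
  have := h _ (hmem x X hX hX') _ (hmem y Y hY hY') _ (hmem z Z hZ hZ')
  omega

/-- Erasing `p` only merges pairs `A`, `insert p A`, and the edge family counts these pairs. -/
theorem card_le_card_image_erase_add (F : Finset (Finset α)) (p : α) :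
    F.card ≤ (F.image (·.erase p)).card + (edgeFamily F p).card := by
  rw [← Finset.card_filter_add_card_filter_not (s := F) (fun A => p ∈ A ∧ A.erase p ∈ F), add_comm]
  refine Nat.add_le_add ?_ ?_
  · refine Finset.card_le_card_of_injOn (·.erase p) ?_ ?_
    · intro A hA
      simp only [Finset.coe_filter, Set.mem_ofPred_eq] at hA
      exact Finset.mem_coe.2 (Finset.mem_image_of_mem _ hA.1)
    · intro A hA B hB hAB
      simp only [Finset.coe_filter, Set.mem_ofPred_eq] at hA hB
      simp only at hAB
      by_cases hpA : p ∈ A <;> by_cases hpB : p ∈ B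
      · rw [← Finset.insert_erase hpA, hAB, Finset.insert_erase hpB]
      · exact absurd ⟨hpA, by rw [hAB, Finset.erase_eq_of_notMem hpB]; exact hB.1⟩ hA.2
      · exact absurd ⟨hpB, by rw [← hAB, Finset.erase_eq_of_notMem hpA]; exact hA.1⟩ hB.2
      · rwa [Finset.erase_eq_of_notMem hpA, Finset.erase_eq_of_notMem hpB] at hAB
  · refine Finset.card_le_card_of_injOn (·.erase p) ?_ ?_
    · intro A hA
      simp only [Finset.coe_filter, Set.mem_ofPred_eq] at hA
      refine Finset.mem_coe.2 (mem_edgeFamily.2 ⟨hA.2.2, by simp, ?_⟩)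
      rw [Finset.insert_erase hA.2.1]; exact hA.1
    · intro A hA B hB hAB
      simp only [Finset.coe_filter, Set.mem_ofPred_eq] at hA hB
      simp only at hAB
      rw [← Finset.insert_erase hA.2.1, hAB, Finset.insert_erase hB.2.1]

theorem image_erase_trace (F : Finset (Finset α)) (U : Finset α) (p : α) :
    (trace F U).image (·.erase p) = trace F (U.erase p) := by
  simp only [trace, Finset.image_image]
  congr 1
  ext A a
  simp only [Function.comp, Finset.mem_erase, Finset.mem_inter]
  tauto

/-- A family with many members has a trace all of whose edge families are large. -/
theorem exists_trace_edgeFamily_large (F : Finset (Finset α)) (U : Finset α) (c : ℕ)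
    (h : c * U.card + 1 < (trace F U).card) :
    ∃ V ⊆ U, V.Nonempty ∧ ∀ q ∈ V, c < (edgeFamily (trace F V) q).card := by
  induction U using Finset.strongInduction with
  | H U ih =>
    by_cases hU : ∃ q ∈ U, (edgeFamily (trace F U) q).card ≤ c
    · obtain ⟨q, hq, hc⟩ := hU
      -- Deleting `q` loses at most `c` sets while `c * U.card` drops by `c`, so `h` survives.
      have h1 := card_le_card_image_erase_add (trace F U) q
      rw [image_erase_trace] at h1
      have h2 := Finset.card_erase_add_one hq
      rw [← h2] at h
      obtain ⟨V, hV, h3⟩ := ih (U.erase q) (Finset.erase_ssubset hq) (by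
        rw [mul_add] at h; omega)
      exact ⟨V, hV.trans (Finset.erase_subset _ _), h3⟩
    · push Not at hU
      refine ⟨U, subset_rfl, ?_, hU⟩
      by_contra hne
      rw [Finset.not_nonempty_iff_eq_empty] at hne
      subst hne
      have : trace F ∅ ⊆ {∅} := by
        intro A hA
        obtain ⟨B, -, rfl⟩ := mem_trace.1 hA
        simp
      have := Finset.card_le_card this
      simp at this h
      omega

/-! ### Laminar families -/

/-- Any two members are disjoint or nested. -/
def Laminar (H : Finset (Finset α)) : Prop :=
  ∀ X ∈ H, ∀ Y ∈ H, Disjoint X Y ∨ X ⊆ Y ∨ Y ⊆ X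

/-- If `X` and `Y` cross, their three regions already use up the three patterns with any `Z`. So `Z`
has no point outside `X ∪ Y` and contains or misses each region whole, leaving eight choices. -/
theorem VennFree.laminar {H : Finset (Finset α)} (h : VennFree 3 H) (hc : 8 < H.card) :
    Laminar H := by
  intro X hX Y hY
  by_contra! hXY
  obtain ⟨h1, h2, h3⟩ := hXY
  obtain ⟨a, haX, haY⟩ := Finset.not_disjoint_iff.1 h1
  obtain ⟨b, hbX, hbY⟩ := Finset.not_subset.1 h2
  obtain ⟨d, hdY, hdX⟩ := Finset.not_subset.1 h3
  have key : ∀ Z ∈ H, venn X Y Z =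
      {(true, true, decide (a ∈ Z)), (true, false, decide (b ∈ Z)),
        (false, true, decide (d ∈ Z))} := by
    intro Z hZ
    symm
    refine Finset.eq_of_subset_of_card_le ?_ ?_
    · intro t ht
      simp only [Finset.mem_insert, Finset.mem_singleton] at ht
      rcases ht with rfl | rfl | rfl
      · exact mem_venn_of _ _ _ a (by simpa) (by simpa) (by simp) (by simp)
      · exact mem_venn_of _ _ _ b (by simpa) (by simpa) (by simp) (by simp)
      · exact mem_venn_of _ _ _ d (by simpa) (by simpa) (by simp) (by simp)
    · refine (h X hX Y hY Z hZ).trans ?_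
      rw [Finset.card_insert_of_notMem (by simp), Finset.card_insert_of_notMem (by simp),
        Finset.card_singleton]
  have hdet : ∀ Z ∈ H, ∀ e, e ∈ Z ↔
      (e ∈ X ∧ e ∈ Y ∧ a ∈ Z) ∨ (e ∈ X ∧ e ∉ Y ∧ b ∈ Z) ∨ (e ∉ X ∧ e ∈ Y ∧ d ∈ Z) := by
    intro Z hZ e
    by_cases he : e ∈ X ∪ Y ∪ Z
    · have : (decide (e ∈ X), decide (e ∈ Y), decide (e ∈ Z)) ∈ venn X Y Z :=
        Finset.mem_image_of_mem _ he
      rw [key Z hZ] at this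
      simp only [Finset.mem_insert, Finset.mem_singleton, Prod.mk.injEq, decide_eq_true_eq,
        decide_eq_false_iff_not, decide_eq_decide] at this
      tauto
    · simp only [Finset.mem_union, not_or] at he
      tauto
  have hinj : H.card ≤ (Finset.univ : Finset (Bool × Bool × Bool)).card := by
    refine Finset.card_le_card_of_injOn
      (fun Z => (decide (a ∈ Z), decide (b ∈ Z), decide (d ∈ Z))) (by simp) ?_
    intro Z hZ Z' hZ' hZZ
    simp only [Prod.mk.injEq, decide_eq_decide] at hZZ
    ext e
    rw [hdet Z hZ, hdet Z' hZ', hZZ.1, hZZ.2.1, hZZ.2.2]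
  simp at hinj
  omega

omit [DecidableEq α] in
theorem Laminar.mono {G H : Finset (Finset α)} (h : Laminar H) (hG : G ⊆ H) : Laminar G :=
  fun X hX Y hY => h X (hG hX) Y (hG hY)

/-- A laminar family without chains of length three is the union of two families of pairwise
disjoint sets. -/
theorem Laminar.exists_union_pairwiseDisjoint {H : Finset (Finset α)} (h : Laminar H)
    (hch : ∀ A ∈ H, ∀ B ∈ H, ∀ C ∈ H, A ⊂ B → ¬ B ⊂ C) :
    ∃ M N : Finset (Finset α), M ∪ N = H ∧ (M : Set (Finset α)).PairwiseDisjoint id ∧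
      (N : Set (Finset α)).PairwiseDisjoint id := by
  -- The maximal and the non-maximal members: two nested non-maximal ones would extend to a chain of
  -- three.
  refine ⟨H.filter fun A => ∀ E ∈ H, A ⊆ E → A = E, H.filter fun A => ¬ ∀ E ∈ H, A ⊆ E → A = E,
    Finset.filter_union_filter_not_eq _ _, ?_, ?_⟩
  · intro A hA B hB hAB
    simp only [Finset.coe_filter, Set.mem_ofPred_eq] at hA hB
    rcases h A hA.1 B hB.1 with h1 | h1 | h1
    · exact h1
    · exact absurd (hA.2 B hB.1 h1) hAB
    · exact absurd (hB.2 A hA.1 h1) hAB.symm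
  · intro A hA B hB hAB
    simp only [Finset.coe_filter, Set.mem_ofPred_eq, not_forall] at hA hB
    obtain ⟨hA, E, hE, hAE, hAE'⟩ := hA
    obtain ⟨hB, E', hE', hBE, hBE'⟩ := hB
    rcases h A hA B hB with h1 | h1 | h1
    · exact h1
    · exact absurd (hBE.ssubset_of_ne hBE') (hch A hA B hB E' hE' (h1.ssubset_of_ne hAB))
    · exact absurd (hAE.ssubset_of_ne hAE') (hch B hB A hA E hE (h1.ssubset_of_ne hAB.symm))

theorem card_filter_mem_le_one {M : Finset (Finset α)}
    (h : (M : Set (Finset α)).PairwiseDisjoint id) (x : α) :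
    (M.filter fun A => x ∈ A).card ≤ 1 := by
  rw [Finset.card_le_one]
  intro A hA B hB
  rw [Finset.mem_filter] at hA hB
  by_contra hAB
  exact Finset.disjoint_left.1 (h hA.1 hB.1 hAB) hA.2 hB.2

theorem Laminar.card_filter_mem_le_two {H : Finset (Finset α)} (h : Laminar H) (x : α)
    (hch : ∀ A ∈ H, ∀ B ∈ H, ∀ C ∈ H, A ⊂ B → ¬ B ⊂ C) (hx : ∀ A ∈ H, x ∈ A) : H.card ≤ 2 := by
  obtain ⟨M, N, rfl, hM, hN⟩ := h.exists_union_pairwiseDisjoint hch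
  have h1 := card_filter_mem_le_one hM x
  have h2 := card_filter_mem_le_one hN x
  rw [Finset.filter_true_of_mem fun A hA => hx A (Finset.mem_union_left _ hA)] at h1
  rw [Finset.filter_true_of_mem fun A hA => hx A (Finset.mem_union_right _ hA)] at h2
  have := Finset.card_union_le M N
  omega

theorem Laminar.exists_pairwiseDisjoint {H : Finset (Finset α)} (h : Laminar H)
    (hch : ∀ A ∈ H, ∀ B ∈ H, ∀ C ∈ H, A ⊂ B → ¬ B ⊂ C) (k : ℕ) (hk : 2 * k ≤ H.card) :
    ∃ D ⊆ H, k ≤ D.card ∧ (D : Set (Finset α)).PairwiseDisjoint id := by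
  obtain ⟨M, N, rfl, hM, hN⟩ := h.exists_union_pairwiseDisjoint hch
  have := Finset.card_union_le M N
  by_cases hkM : k ≤ M.card
  · exact ⟨M, Finset.subset_union_left, hkM, hM⟩
  · exact ⟨N, Finset.subset_union_right, by omega, hN⟩

/-! ### Disjoint stars in 4-free families -/

theorem VennFree.false_of_subset {k : ℕ} {F : Finset (Finset α)} (h : VennFree k F)
    {X Y Z : Finset α} (hX : X ∈ F) (hY : Y ∈ F) (hZ : Z ∈ F) (T : Finset (Bool × Bool × Bool))
    (hT : T ⊆ venn X Y Z) (hk : k < T.card) : False := by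
  have := h X hX Y hY Z hZ
  have := Finset.card_le_card hT
  omega

/-- Sets in the edge family of a point between two nested sets of another edge family. -/
theorem VennFree.edgeFamily_between {G : Finset (Finset α)} (hG : VennFree 4 G) {q r s : α}
    {A C D : Finset α} (hA : A ∈ edgeFamily G q) (hC : C ∈ edgeFamily G q) (hAC : A ⊆ C)
    (hne : A.Nonempty) (hr : r ∈ C \ A) (hs : s ∈ C \ A) (hsr : s ≠ r)
    (hD : D ∈ edgeFamily G r) : (Disjoint A D ∨ A ⊆ D) ∧ D ⊆ insert q C := by
  obtain ⟨hA, hqA, hA'⟩ := mem_edgeFamily.1 hA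
  obtain ⟨hC, hqC, hC'⟩ := mem_edgeFamily.1 hC
  obtain ⟨hD, hrD, hD'⟩ := mem_edgeFamily.1 hD
  rw [Finset.mem_sdiff] at hr hs
  have hrq : r ≠ q := fun h => hqC (h ▸ hr.1)
  have hsq : s ≠ q := fun h => hqC (h ▸ hs.1)
  -- Taking or leaving `r` makes `Y` separate `r` from `s`. With `q` this fills three patterns, so
  -- two more are contradictory.
  obtain ⟨Y, hY, hYe, hFTT, hFTF⟩ : ∃ Y ∈ G, (∀ e, e ≠ r → (e ∈ Y ↔ e ∈ D)) ∧
      (false, true, true) ∈ venn (insert q A) C Y ∧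
      (false, true, false) ∈ venn (insert q A) C Y := by
    by_cases hsD : s ∈ D
    · exact ⟨D, hD, fun _ _ => Iff.rfl,
        mem_venn_of _ _ _ s (by simp [hsq, hs.2]) (by simp [hs.1]) (by simp [hsD]),
        mem_venn_of _ _ _ r (by simp [hrq, hr.2]) (by simp [hr.1]) (by simp [hrD])⟩
    · exact ⟨insert r D, hD', fun e he => by simp [he],
        mem_venn_of _ _ _ r (by simp [hrq, hr.2]) (by simp [hr.1]) (by simp),
        mem_venn_of _ _ _ s (by simp [hsq, hs.2]) (by simp [hs.1]) (by simp [hsD, hsr])⟩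
  have hq : (true, false, decide (q ∈ Y)) ∈ venn (insert q A) C Y :=
    mem_venn_of _ _ _ q (by simp) (by simp [hqC]) (by simp)
  refine ⟨?_, ?_⟩
  · by_contra! hcon
    obtain ⟨a, haA, haD⟩ := Finset.not_disjoint_iff.1 hcon.1
    obtain ⟨b, hbA, hbD⟩ := Finset.not_subset.1 hcon.2
    have har : a ≠ r := fun h => hr.2 (h ▸ haA)
    have hbr : b ≠ r := fun h => hr.2 (h ▸ hbA)
    have ha : (true, true, true) ∈ venn (insert q A) C Y :=
      mem_venn_of _ _ _ a (by simp [haA]) (by simp [hAC haA]) (by simp [hYe a har, haD])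
    have hb : (true, true, false) ∈ venn (insert q A) C Y :=
      mem_venn_of _ _ _ b (by simp [hbA]) (by simp [hAC hbA]) (by simp [hYe b hbr, hbD])
    refine hG.false_of_subset hA' hC hY {(false, true, true), (false, true, false),
      (true, false, decide (q ∈ Y)), (true, true, true), (true, true, false)} ?_ ?_
    · simp [Finset.insert_subset_iff, *]
    · generalize decide (q ∈ Y) = y
      revert y; decide
  · by_contra hcon
    obtain ⟨d, hdD, hd⟩ := Finset.not_subset.1 hcon
    rw [Finset.mem_insert, not_or] at hd
    obtain ⟨a, haA⟩ := hne
    have hdr : d ≠ r := fun h => hrD (h ▸ hdD)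
    have ha : (true, true, decide (a ∈ Y)) ∈ venn (insert q A) C Y :=
      mem_venn_of _ _ _ a (by simp [haA]) (by simp [hAC haA]) (by simp)
    have hd' : (false, false, true) ∈ venn (insert q A) C Y :=
      mem_venn_of _ _ _ d (by simpa [hd.1] using fun h => hd.2 (hAC h)) (by simp [hd.2])
        (by simp [hYe d hdr, hdD])
    refine hG.false_of_subset hA' hC hY {(false, true, true), (false, true, false),
      (true, false, decide (q ∈ Y)), (true, true, decide (a ∈ Y)), (false, false, true)} ?_ ?_
    · simp [Finset.insert_subset_iff, *]
    · generalize decide (q ∈ Y) = y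
      generalize decide (a ∈ Y) = y'
      revert y y'; decide

/-- A family with large edge families contains, on some nonempty set `S`, large families of
pairwise disjoint sets in the edge family of every point of `S`. -/
theorem VennFree.exists_disjoint_stars {G : Finset (Finset α)} {V : Finset α}
    (hG : VennFree 4 G) (hGV : ∀ A ∈ G, A ⊆ V) (hV : V.Nonempty)
    (hdeg : ∀ q ∈ V, 20 < (edgeFamily G q).card) :
    ∃ S ⊆ V, S.Nonempty ∧ ∀ r ∈ S, ∃ D ⊆ edgeFamily G r, 5 ≤ D.card ∧
      (∀ A ∈ D, A.Nonempty ∧ A ⊆ S) ∧ (D : Set (Finset α)).PairwiseDisjoint id := by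
  have hlam : ∀ q ∈ V, Laminar (edgeFamily G q) := fun q hq =>
    (vennFree_edgeFamily hG (by norm_num) q).laminar (by have := hdeg q hq; omega)
  have hcard : ∀ q ∈ V, 20 ≤ ((edgeFamily G q).erase ∅).card := fun q hq => by
    have := hdeg q hq
    have := Finset.pred_card_le_card_erase (s := edgeFamily G q) (a := ∅)
    omega
  -- If chains of three nonempty sets exist, one with `C \ A` smallest gives `S = C \ A`; otherwise
  -- `S = V`.
  let P : ℕ → Prop := fun m => ∃ q ∈ V, ∃ A ∈ edgeFamily G q,
    ∃ B ∈ edgeFamily G q, ∃ C ∈ edgeFamily G q,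
      A.Nonempty ∧ A ⊂ B ∧ B ⊂ C ∧ (C \ A).card = m
  by_cases hP : ∃ m, P m
  · classical
    obtain ⟨q, hq, A, hA, B, hB, C, hC, hne, hAB, hBC, hm⟩ := Nat.find_spec hP
    have hmin : ∀ q' ∈ V, ∀ A' ∈ edgeFamily G q', ∀ B' ∈ edgeFamily G q',
        ∀ C' ∈ edgeFamily G q', A'.Nonempty → A' ⊂ B' → B' ⊂ C' →
          ¬ (C' \ A' ⊂ C \ A) := by
      intro q' hq' A' hA' B' hB' C' hC' h1 h2 h3 h4
      refine Nat.find_min hP ?_ ⟨q', hq', A', hA', B', hB', C', hC', h1, h2, h3, rfl⟩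
      rw [← hm]
      exact Finset.card_lt_card h4
    have hCV : C ⊆ V := hGV C (mem_edgeFamily.1 hC).1
    have hAC : A ⊆ C := (hAB.trans hBC).subset
    obtain ⟨a, haA⟩ := hne
    obtain ⟨b, hbB, hbA⟩ := Finset.exists_of_ssubset hAB
    obtain ⟨c, hcC, hcB⟩ := Finset.exists_of_ssubset hBC
    refine ⟨C \ A, Finset.sdiff_subset.trans hCV,
      ⟨b, Finset.mem_sdiff.2 ⟨hBC.subset hbB, hbA⟩⟩, ?_⟩
    intro r hr
    obtain ⟨s, hs, hsr⟩ : ∃ s ∈ C \ A, s ≠ r := by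
      by_cases hbr : b = r
      · refine ⟨c, Finset.mem_sdiff.2 ⟨hcC, fun h => hcB (hAB.subset h)⟩, ?_⟩
        rintro rfl
        exact hcB (hbr ▸ hbB)
      · exact ⟨b, Finset.mem_sdiff.2 ⟨hBC.subset hbB, hbA⟩, hbr⟩
    have hrV : r ∈ V := hCV (Finset.mem_sdiff.1 hr).1
    have hbet : ∀ D ∈ edgeFamily G r, (Disjoint A D ∨ A ⊆ D) ∧ D ⊆ insert q C :=
      fun D hD => hG.edgeFamily_between hA hC hAC ⟨a, haA⟩ hr hs hsr hD
    set H := (edgeFamily G r).erase ∅ with hH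
    have hHlam : Laminar H := (hlam r hrV).mono (Finset.erase_subset _ _)
    -- Within a class of sets agreeing on `a` and `q` there is no chain of length three.
    have hclass : ∀ H' ⊆ H, (∀ D ∈ H', ∀ D' ∈ H', (a ∈ D ↔ a ∈ D') ∧ (q ∈ D ↔ q ∈ D')) →
        ∀ X ∈ H', ∀ Y ∈ H', ∀ Z ∈ H', X ⊂ Y → ¬ Y ⊂ Z := by
      intro H' hH' hag X hX Y hY Z hZ hXY hYZ
      have hX1 := Finset.mem_erase.1 (hH' hX)
      have hY1 := Finset.mem_erase.1 (hH' hY)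
      have hZ1 := Finset.mem_erase.1 (hH' hZ)
      refine hmin r hrV X hX1.2 Y hY1.2 Z hZ1.2 (Finset.nonempty_iff_ne_empty.2 hX1.1) hXY hYZ ?_
      refine Finset.ssubset_iff_subset_ne.2 ⟨?_, ?_⟩
      · intro e he
        rw [Finset.mem_sdiff] at he ⊢
        have heq : e ≠ q := by
          rintro rfl
          exact he.2 ((hag Z hZ X hX).2.1 he.1)
        refine ⟨(Finset.mem_insert.1 ((hbet Z hZ1.2).2 he.1)).resolve_left heq, fun heA => ?_⟩
        have haZ : a ∈ Z := by
          rcases (hbet Z hZ1.2).1 with h | h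
          · exact absurd he.1 (Finset.disjoint_left.1 h heA)
          · exact h haA
        have haX : a ∈ X := (hag Z hZ X hX).1.1 haZ
        rcases (hbet X hX1.2).1 with h | h
        · exact Finset.disjoint_left.1 h haA haX
        · exact he.2 (h heA)
      -- Strictness: `r` lies in `C \ A` but not in `Z`.
      · intro heq
        rw [← heq, Finset.mem_sdiff] at hr
        exact (mem_edgeFamily.1 hZ1.2).2.1 hr.1
    have h1 : (H.filter fun D => a ∈ D ∧ q ∈ D).card ≤ 2 :=
      (hHlam.mono (Finset.filter_subset _ _)).card_filter_mem_le_two a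
        (hclass _ (Finset.filter_subset _ _) fun D hD D' hD' => by
          simp only [Finset.mem_filter] at hD hD'; tauto)
        fun D hD => (Finset.mem_filter.1 hD).2.1
    have h2 : (H.filter fun D => a ∈ D ∧ q ∉ D).card ≤ 2 :=
      (hHlam.mono (Finset.filter_subset _ _)).card_filter_mem_le_two a
        (hclass _ (Finset.filter_subset _ _) fun D hD D' hD' => by
          simp only [Finset.mem_filter] at hD hD'; tauto)
        fun D hD => (Finset.mem_filter.1 hD).2.1
    have h3 : (H.filter fun D => a ∉ D ∧ q ∈ D).card ≤ 2 :=
      (hHlam.mono (Finset.filter_subset _ _)).card_filter_mem_le_two q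
        (hclass _ (Finset.filter_subset _ _) fun D hD D' hD' => by
          simp only [Finset.mem_filter] at hD hD'; tauto)
        fun D hD => (Finset.mem_filter.1 hD).2.2
    have hsum : H.card = (H.filter fun D => a ∈ D ∧ q ∈ D).card +
        (H.filter fun D => a ∈ D ∧ q ∉ D).card + ((H.filter fun D => a ∉ D ∧ q ∈ D).card +
        (H.filter fun D => a ∉ D ∧ q ∉ D).card) := by
      simp only [← Finset.filter_filter, Finset.card_filter_add_card_filter_not]
    have h20 : 20 ≤ H.card := hcard r hrV
    -- At most six of the twenty sets contain `a` or `q`. The other fourteen lie inside `C \ A` and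
    -- split into two disjoint families.
    obtain ⟨D, hDH, hD5, hDd⟩ :=
      (hHlam.mono (Finset.filter_subset _ _)).exists_pairwiseDisjoint
        (hclass (H.filter fun D => a ∉ D ∧ q ∉ D) (Finset.filter_subset _ _)
          fun D hD D' hD' => by simp only [Finset.mem_filter] at hD hD'; tauto) 5 (by omega)
    refine ⟨D, fun X hX => Finset.mem_of_mem_erase (Finset.mem_filter.1 (hDH hX)).1, hD5, ?_, hDd⟩
    intro X hX
    obtain ⟨hXH, haX, hqX⟩ := Finset.mem_filter.1 (hDH hX)
    obtain ⟨hX0, hXG⟩ := Finset.mem_erase.1 hXH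
    refine ⟨Finset.nonempty_iff_ne_empty.2 hX0, fun e he => Finset.mem_sdiff.2 ⟨?_, fun heA => ?_⟩⟩
    · refine (Finset.mem_insert.1 ((hbet X hXG).2 he)).resolve_left ?_
      rintro rfl
      exact hqX he
    · rcases (hbet X hXG).1 with h | h
      · exact Finset.disjoint_left.1 h heA he
      · exact haX (h haA)
  · refine ⟨V, subset_rfl, hV, fun r hr => ?_⟩
    have h20 := hcard r hr
    obtain ⟨D, hDH, hD5, hDd⟩ :=
      ((hlam r hr).mono (Finset.erase_subset ∅ _)).exists_pairwiseDisjoint (by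
        intro X hX Y hY Z hZ hXY hYZ
        rw [Finset.mem_erase] at hX hY hZ
        exact hP ⟨_, r, hr, X, hX.2, Y, hY.2, Z, hZ.2, Finset.nonempty_iff_ne_empty.2 hX.1,
          hXY, hYZ, rfl⟩) 5 (by omega)
    refine ⟨D, hDH.trans (Finset.erase_subset _ _), hD5, fun X hX => ?_, hDd⟩
    obtain ⟨hX0, hXG⟩ := Finset.mem_erase.1 (hDH hX)
    exact ⟨Finset.nonempty_iff_ne_empty.2 hX0, hGV X (mem_edgeFamily.1 hXG).1⟩

/-! ### Six regions from stars and a second extension point -/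

/-- Two sets of an edge family containing `z` and a set that can be extended by `z` cannot form
a star with disjoint petals. -/
theorem VennFree.false_of_star {F : Finset (Finset α)} (hF : VennFree 5 F) {p q r z b c : α}
    {A X Y : Finset α} (hA : A ∈ edgeFamily F p) (hX : X ∈ edgeFamily F p)
    (hY : Y ∈ edgeFamily F p) (hzp : z ≠ p) (hzA : z ∉ A) (hzX : z ∈ X) (hzY : z ∈ Y)
    (hqA : q ∈ A) (hqX : q ∈ X) (hqY : q ∈ Y) (hrA : r ∈ A) (hrX : r ∉ X) (hrY : r ∉ Y)
    (hbX : b ∈ X) (hbY : b ∉ Y) (hbA : b ∉ A) (hcX : c ∉ X) (hcY : c ∈ Y) (hcA : c ∉ A) :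
    False := by
  obtain ⟨hA, hpA, hA'⟩ := mem_edgeFamily.1 hA
  obtain ⟨hX, hpX, hX'⟩ := mem_edgeFamily.1 hX
  obtain ⟨hY, hpY, hY'⟩ := mem_edgeFamily.1 hY
  have hqp : q ≠ p := fun h => hpA (h ▸ hqA)
  have hrp : r ≠ p := fun h => hpA (h ▸ hrA)
  have hbp : b ≠ p := fun h => hpX (h ▸ hbX)
  have hcp : c ≠ p := fun h => hpY (h ▸ hcY)
  have h1 : (true, false, true) ∈ venn (insert p X) Y (insert p A) :=
    mem_venn_of _ _ _ p (by simp) (by simp [hpY]) (by simp)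
  have h2 : (true, true, true) ∈ venn (insert p X) Y (insert p A) :=
    mem_venn_of _ _ _ q (by simp [hqX]) (by simp [hqY]) (by simp [hqA])
  have h3 : (false, false, true) ∈ venn (insert p X) Y (insert p A) :=
    mem_venn_of _ _ _ r (by simp [hrX, hrp]) (by simp [hrY]) (by simp [hrA])
  have h4 : (true, true, false) ∈ venn (insert p X) Y (insert p A) :=
    mem_venn_of _ _ _ z (by simp [hzX]) (by simp [hzY]) (by simp [hzA, hzp])
  have h5 : (true, false, false) ∈ venn (insert p X) Y (insert p A) :=
    mem_venn_of _ _ _ b (by simp [hbX]) (by simp [hbY]) (by simp [hbA, hbp])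
  have h6 : (false, true, false) ∈ venn (insert p X) Y (insert p A) :=
    mem_venn_of _ _ _ c (by simp [hcX, hcp]) (by simp [hcY]) (by simp [hcA, hcp])
  refine hF.false_of_subset hX' hY hA' {(true, false, true), (true, true, true),
    (false, false, true), (true, true, false), (true, false, false), (false, true, false)} ?_
    (by decide)
  simp [Finset.insert_subset_iff, *]

/-- A path in an edge family whose middle set can be extended by a point outside the other two
sets fills six regions. -/
theorem VennFree.false_of_path {F : Finset (Finset α)} (hF : VennFree 5 F) {p q r z b c : α}
    {A X Y : Finset α} (hpA : p ∉ A) (hA : insert z A ∈ F) (hX : X ∈ edgeFamily F p)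
    (hY : Y ∈ edgeFamily F p) (hzp : z ≠ p) (hzX : z ∉ X) (hzY : z ∉ Y)
    (hqA : q ∈ A) (hqX : q ∈ X) (hqY : q ∉ Y) (hrA : r ∈ A) (hrX : r ∉ X) (hrY : r ∈ Y)
    (hbX : b ∈ X) (hbY : b ∉ Y) (hbA : b ∉ A) (hcX : c ∉ X) (hcY : c ∈ Y) (hcA : c ∉ A) :
    False := by
  obtain ⟨hX, hpX, hX'⟩ := mem_edgeFamily.1 hX
  obtain ⟨hY, hpY, hY'⟩ := mem_edgeFamily.1 hY
  have hqp : q ≠ p := fun h => hpA (h ▸ hqA)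
  have hrp : r ≠ p := fun h => hpA (h ▸ hrA)
  have hbp : b ≠ p := fun h => hpX (h ▸ hbX)
  have hcp : c ≠ p := fun h => hpY (h ▸ hcY)
  have hbz : b ≠ z := fun h => hzX (h ▸ hbX)
  have hcz : c ≠ z := fun h => hzY (h ▸ hcY)
  have h1 : (true, true, false) ∈ venn (insert p X) (insert p Y) (insert z A) :=
    mem_venn_of _ _ _ p (by simp) (by simp) (by simp [hpA, hzp.symm])
  have h2 : (true, false, true) ∈ venn (insert p X) (insert p Y) (insert z A) :=
    mem_venn_of _ _ _ q (by simp [hqX]) (by simp [hqY, hqp]) (by simp [hqA])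
  have h3 : (false, true, true) ∈ venn (insert p X) (insert p Y) (insert z A) :=
    mem_venn_of _ _ _ r (by simp [hrX, hrp]) (by simp [hrY]) (by simp [hrA])
  have h4 : (false, false, true) ∈ venn (insert p X) (insert p Y) (insert z A) :=
    mem_venn_of _ _ _ z (by simp [hzX, hzp]) (by simp [hzY, hzp]) (by simp)
  have h5 : (true, false, false) ∈ venn (insert p X) (insert p Y) (insert z A) :=
    mem_venn_of _ _ _ b (by simp [hbX]) (by simp [hbY, hbp]) (by simp [hbA, hbz])
  have h6 : (false, true, false) ∈ venn (insert p X) (insert p Y) (insert z A) :=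
    mem_venn_of _ _ _ c (by simp [hcX, hcp]) (by simp [hcY]) (by simp [hcA, hcz])
  refine hF.false_of_subset hX' hY' hA {(true, true, false), (true, false, true),
    (false, true, true), (false, false, true), (true, false, false), (false, true, false)} ?_
    (by decide)
  simp [Finset.insert_subset_iff, *]

/-- In a `4`-free family, a smallest petal among stars of pairwise disjoint sets is a
singleton. -/
theorem VennFree.eq_singleton_of_minimal {G : Finset (Finset α)} (hG : VennFree 4 G)
    {q r : α} {B : Finset α} {M N : Finset (Finset α)} (hM : M ⊆ edgeFamily G q)
    (hMd : (M : Set (Finset α)).PairwiseDisjoint id) (hMne : ∀ A ∈ M, A.Nonempty)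
    (hM2 : 2 ≤ M.card) (hBM : B ∈ M) (hrB : r ∈ B) (hN : N ⊆ edgeFamily G r)
    (hNd : (N : Set (Finset α)).PairwiseDisjoint id)
    (hN3 : 3 ≤ N.card) (hmin : ∀ D ∈ N, B.card ≤ D.card) : B = {r} := by
  refine Finset.eq_singleton_iff_unique_mem.2 ⟨hrB, ?_⟩
  by_contra! hcon
  obtain ⟨s, hsB, hsr⟩ := hcon
  obtain ⟨B', hB'M, hBB'⟩ := Finset.exists_mem_ne (by omega : 1 < M.card) B
  obtain ⟨b, hb⟩ := hMne B' hB'M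
  obtain ⟨hBG, hqB, hB1⟩ := mem_edgeFamily.1 (hM hBM)
  obtain ⟨hB'G, hqB', hB'1⟩ := mem_edgeFamily.1 (hM hB'M)
  have hdisj : Disjoint B' B := hMd hB'M hBM hBB'
  have hrB' : r ∉ B' := fun h => Finset.disjoint_left.1 hdisj h hrB
  have hsB' : s ∉ B' := fun h => Finset.disjoint_left.1 hdisj h hsB
  have hqr : q ≠ r := fun h => hqB (h ▸ hrB)
  have hqs : q ≠ s := fun h => hqB (h ▸ hsB)
  have hcard1 := card_filter_mem_le_one hNd q
  have hcard2 := card_filter_mem_le_one hNd b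
  -- A member of `N` avoiding `q` and `b` would fill five regions, but at most two of the three or
  -- more disjoint members meet `{q, b}`.
  have hsub : N ⊆ (N.filter fun A => q ∈ A) ∪ (N.filter fun A => b ∈ A) := by
    intro D hDN
    simp only [Finset.mem_union, Finset.mem_filter, hDN, true_and]
    by_contra! hD
    obtain ⟨hqD, hbD⟩ := hD
    obtain ⟨hDG, hrD, hD1⟩ := mem_edgeFamily.1 (hN hDN)
    obtain ⟨d, hdD, hdB⟩ : ∃ d ∈ D, d ∉ B := by
      refine Finset.not_subset.1 fun h => ?_
      have := Finset.card_lt_card (Finset.ssubset_iff_subset_ne.2 ⟨h, fun he => hrD (he ▸ hrB)⟩)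
      have := hmin D hDN
      omega
    have hdr : d ≠ r := fun h => hrD (h ▸ hdD)
    have hdq : d ≠ q := fun h => hqD (h ▸ hdD)
    have hbq : b ≠ q := fun h => hqB' (h ▸ hb)
    have hbr : b ≠ r := fun h => hrB' (h ▸ hb)
    have hbB : b ∉ B := fun h => Finset.disjoint_left.1 hdisj hb h
    obtain ⟨Y, hY, hYe, h1, h2⟩ : ∃ Y ∈ G, (∀ e, e ≠ r → (e ∈ Y ↔ e ∈ D)) ∧
        (false, true, true) ∈ venn (insert q B') Y (insert q B) ∧
        (false, false, true) ∈ venn (insert q B') Y (insert q B) := by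
      by_cases hsD : s ∈ D
      · exact ⟨D, hDG, fun _ _ => Iff.rfl,
          mem_venn_of _ _ _ s (by simp [hqs.symm, hsB']) (by simp [hsD]) (by simp [hsB]),
          mem_venn_of _ _ _ r (by simp [hqr.symm, hrB']) (by simp [hrD]) (by simp [hrB])⟩
      · exact ⟨insert r D, hD1, fun e he => by simp [he],
          mem_venn_of _ _ _ r (by simp [hqr.symm, hrB']) (by simp) (by simp [hrB]),
          mem_venn_of _ _ _ s (by simp [hqs.symm, hsB']) (by simp [hsD, hsr]) (by simp [hsB])⟩
    have h3 : (true, false, true) ∈ venn (insert q B') Y (insert q B) :=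
      mem_venn_of _ _ _ q (by simp) (by simp [hYe q hqr, hqD]) (by simp)
    have h4 : (true, false, false) ∈ venn (insert q B') Y (insert q B) :=
      mem_venn_of _ _ _ b (by simp [hb]) (by simp [hYe b hbr, hbD]) (by simp [hbq, hbB])
    have h5 : (decide (d ∈ B'), true, false) ∈ venn (insert q B') Y (insert q B) :=
      mem_venn_of _ _ _ d (by simp [hdq]) (by simp [hYe d hdr, hdD]) (by simp [hdq, hdB])
        (by simp)
    refine hG.false_of_subset hB'1 hY hB1 {(false, true, true), (false, false, true),
      (true, false, true), (true, false, false), (decide (d ∈ B'), true, false)} ?_ ?_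
    · simp [Finset.insert_subset_iff, h1, h2, h3, h4, h5]
    · generalize decide (d ∈ B') = y
      revert y; decide
  have := Finset.card_le_card hsub
  have := Finset.card_union_le (N.filter fun A => q ∈ A) (N.filter fun A => b ∈ A)
  omega

/-- With `A` of trace `{q, r}` and `z` extending `A`, two lifted petals at the same end that contain
`z` and avoid the other end form a forbidden star. So lifts avoiding `z` remain at both ends, and
one from each forms a forbidden path through `insert z A`. -/
theorem VennFree.false_of_edgeFamily_large {F : Finset (Finset α)} (hF : VennFree 5 F) {p : α}
    {B : Finset (Finset α)} {V : Finset α} (hB : B ⊆ edgeFamily F p)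
    (hz : ∀ A ∈ B, ∃ z, z ≠ p ∧ z ∉ A ∧ insert z A ∈ F) (hV : V.Nonempty)
    (hdeg : ∀ q ∈ V, 20 < (edgeFamily (trace B V) q).card) : False := by
  have hG : VennFree 4 (trace B V) :=
    vennFree_trace ((vennFree_edgeFamily hF (by norm_num) p).mono hB) V
  have hGV : ∀ A ∈ trace B V, A ⊆ V := by
    intro A hA
    obtain ⟨A, -, rfl⟩ := mem_trace.1 hA
    exact Finset.inter_subset_right
  obtain ⟨S, hSV, hS, hstar⟩ := hG.exists_disjoint_stars hGV hV hdeg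
  choose! D hDG hD5 hDS hDd using hstar
  have hTne : (S.biUnion D).Nonempty := by
    obtain ⟨s, hs⟩ := hS
    obtain ⟨C, hC⟩ : (D s).Nonempty := Finset.card_pos.1 (by have := hD5 s hs; omega)
    exact ⟨C, Finset.mem_biUnion.2 ⟨s, hs, hC⟩⟩
  obtain ⟨P, hP, hPmin⟩ := Finset.exists_min_image (S.biUnion D) Finset.card hTne
  obtain ⟨q, hqS, hPq⟩ := Finset.mem_biUnion.1 hP
  obtain ⟨r, hrP⟩ := (hDS q hqS P hPq).1
  have hrS : r ∈ S := (hDS q hqS P hPq).2 hrP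
  obtain rfl : P = {r} := hG.eq_singleton_of_minimal (hDG q hqS) (hDd q hqS)
    (fun A hA => (hDS q hqS A hA).1) (by have := hD5 q hqS; omega) hPq hrP (hDG r hrS)
    (hDd r hrS) (by have := hD5 r hrS; omega)
    fun C hC => hPmin C (Finset.mem_biUnion.2 ⟨r, hrS, hC⟩)
  have hlift : ∀ s ∈ S, ∀ C ∈ D s, ∃ X ∈ B, ∀ e ∈ V, e ∈ X ↔ e = s ∨ e ∈ C := by
    intro s hs C hC
    obtain ⟨X, hX, hXC⟩ := mem_trace.1 (mem_edgeFamily.1 (hDG s hs hC)).2.2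
    refine ⟨X, hX, fun e he => ?_⟩
    rw [← Finset.mem_insert, ← hXC, Finset.mem_inter, and_iff_left he]
  choose! f hfB hf using hlift
  have hnot : ∀ s ∈ S, ∀ C ∈ D s, s ∉ C := fun s hs C hC => (mem_edgeFamily.1 (hDG s hs hC)).2.1
  have hDV : ∀ s ∈ S, ∀ C ∈ D s, ∀ e ∈ C, e ∈ V := fun s hs C hC e he =>
    hSV ((hDS s hs C hC).2 he)
  have hqV := hSV hqS
  have hrV := hSV hrS
  have hqr : q ≠ r := by simpa using hnot q hqS _ hPq
  obtain ⟨A, hAB, hA⟩ : ∃ A ∈ B, ∀ e ∈ V, e ∈ A ↔ e = q ∨ e = r :=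
    ⟨f q {r}, hfB q hqS _ hPq, fun e he => by rw [hf q hqS _ hPq e he, Finset.mem_singleton]⟩
  obtain ⟨z, hzp, hzA, hzF⟩ := hz A hAB
  -- At most one petal at `s` lifts to a set containing `z`.
  have hfew : ∀ s ∈ S, ∀ t ∈ S, s ≠ t → (∀ e ∈ V, e ∈ A ↔ e = s ∨ e = t) →
      (((D s).filter fun C => t ∉ C).filter fun C => z ∈ f s C).card ≤ 1 := by
    intro s hs t ht hst hAst
    rw [Finset.card_le_one]
    intro C hC C' hC'
    simp only [Finset.mem_filter] at hC hC'
    obtain ⟨⟨hC, htC⟩, hzC⟩ := hC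
    obtain ⟨⟨hC', htC'⟩, hzC'⟩ := hC'
    by_contra hne
    have hdisj : Disjoint C C' := hDd s hs hC hC' hne
    obtain ⟨b, hb⟩ := (hDS s hs C hC).1
    obtain ⟨c, hc⟩ := (hDS s hs C' hC').1
    have hbV := hDV s hs C hC b hb
    have hcV := hDV s hs C' hC' c hc
    have hbC' := Finset.disjoint_left.1 hdisj hb
    have hcC := Finset.disjoint_right.1 hdisj hc
    have hbs : b ≠ s := fun h => hnot s hs C hC (h ▸ hb)
    have hcs : c ≠ s := fun h => hnot s hs C' hC' (h ▸ hc)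
    have hbt : b ≠ t := fun h => htC (h ▸ hb)
    have hct : c ≠ t := fun h => htC' (h ▸ hc)
    have hsV := hSV hs
    have htV := hSV ht
    refine hF.false_of_star (q := s) (r := t) (b := b) (c := c) (hB hAB) (hB (hfB s hs C hC))
      (hB (hfB s hs C' hC')) hzp hzA hzC hzC' ?_ ?_ ?_ ?_ ?_ ?_ ?_ ?_ ?_ ?_ ?_ ?_ <;>
    first
      | rw [hAst _ (by assumption)]
        simp [*]
      | rw [hf s hs C hC _ (by assumption)]
        simp [*, hst.symm]
      | rw [hf s hs C' hC' _ (by assumption)]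
        simp [*, hst.symm]
  have hX1 := hfew q hqS r hrS hqr hA
  have hY1 := hfew r hrS q hqS hqr.symm fun e he => by rw [hA e he, or_comm]
  -- Of five petals at `s`, at most one contains `t` and at most one more has a lift containing `z`.
  have hlarge : ∀ s ∈ S, ∀ t,
      (((D s).filter fun C => t ∉ C).filter fun C => z ∈ f s C).card ≤ 1 →
      3 ≤ (((D s).filter fun C => t ∉ C).filter fun C => z ∉ f s C).card := by
    intro s hs t h1
    have h2 := card_filter_mem_le_one (hDd s hs) t
    have h3 := Finset.card_filter_add_card_filter_not (s := D s) (fun C => t ∈ C)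
    have h4 := Finset.card_filter_add_card_filter_not (s := (D s).filter fun C => t ∉ C)
      (fun C => z ∈ f s C)
    have := hD5 s hs
    omega
  have hX3 := hlarge q hqS r hX1
  have hY3 := hlarge r hrS q hY1
  set M := ((D q).filter fun C => r ∉ C).filter fun C => z ∉ f q C with hM
  set N := ((D r).filter fun C => q ∉ C).filter fun C => z ∉ f r C with hN
  have hNd : (N : Set (Finset α)).PairwiseDisjoint id :=
    (hDd r hrS).subset fun C hC => by
      simp only [hN, Finset.coe_filter, Finset.mem_filter, Set.mem_ofPred_eq] at hC
      exact hC.1.1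
  obtain ⟨C₁, hC₁, C₂, hC₂, hne⟩ := Finset.one_lt_card.1 (by omega : 1 < M.card)
  simp only [hM, Finset.mem_filter] at hC₁ hC₂
  obtain ⟨b₁, hb₁⟩ := (hDS q hqS C₁ hC₁.1.1).1
  obtain ⟨b₂, hb₂⟩ := (hDS q hqS C₂ hC₂.1.1).1
  obtain ⟨E, hEN, hb₁E, hb₂E⟩ : ∃ E ∈ N, b₁ ∉ E ∧ b₂ ∉ E := by
    by_contra! hcon
    have hsub : N ⊆ (N.filter fun E => b₁ ∈ E) ∪ (N.filter fun E => b₂ ∈ E) := by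
      intro E hE
      simp only [Finset.mem_union, Finset.mem_filter, hE, true_and]
      by_cases h : b₁ ∈ E
      · exact Or.inl h
      · exact Or.inr (hcon E hE h)
    have h1 := Finset.card_le_card hsub
    have h2 := Finset.card_union_le (N.filter fun E => b₁ ∈ E) (N.filter fun E => b₂ ∈ E)
    have h3 := card_filter_mem_le_one hNd b₁
    have h4 := card_filter_mem_le_one hNd b₂
    omega
  simp only [hN, Finset.mem_filter] at hEN
  obtain ⟨⟨hE, hqE⟩, hzE⟩ := hEN
  obtain ⟨d, hd⟩ := (hDS r hrS E hE).1
  have hpath : ∀ C ∈ D q, r ∉ C → z ∉ f q C → ∀ b ∈ C, b ∉ E → d ∉ C → False := by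
    intro C hC hrC hzC b hb hbE hdC
    have hbV := hDV q hqS C hC b hb
    have hdV := hDV r hrS E hE d hd
    have hbq : b ≠ q := fun h => hnot q hqS C hC (h ▸ hb)
    have hbr : b ≠ r := fun h => hrC (h ▸ hb)
    have hdq : d ≠ q := fun h => hqE (h ▸ hd)
    have hdr : d ≠ r := fun h => hnot r hrS E hE (h ▸ hd)
    have hrq := hqr.symm
    refine hF.false_of_path (q := q) (r := r) (b := b) (c := d)
      (mem_edgeFamily.1 (hB hAB)).2.1 hzF (hB (hfB q hqS C hC)) (hB (hfB r hrS E hE))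
      hzp hzC hzE ?_ ?_ ?_ ?_ ?_ ?_ ?_ ?_ ?_ ?_ ?_ ?_ <;>
    first
      | rw [hA _ (by assumption)]
        simp [*]
      | rw [hf q hqS C hC _ (by assumption)]
        simp [*]
      | rw [hf r hrS E hE _ (by assumption)]
        simp [*]
  -- `C₁` and `C₂` are disjoint, so one of them misses `d`.
  by_cases hdC : d ∈ C₁
  · exact hpath C₂ hC₂.1.1 hC₂.1.2 hC₂.2 b₂ hb₂ hb₂E
      (Finset.disjoint_left.1 (hDd q hqS hC₁.1.1 hC₂.1.1 hne) hdC)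
  · exact hpath C₁ hC₁.1.1 hC₁.1.2 hC₁.2 b₁ hb₁ hb₁E hdC

/-! ### Double counting and induction -/

/-- The members of the edge family of `p` lying in a further edge family are few. -/
theorem VennFree.card_edgeFamily_repeated_le {F : Finset (Finset α)} (hF : VennFree 5 F)
    {U : Finset α} (hFU : ∀ A ∈ F, A ⊆ U) (p : α) :
    ((edgeFamily F p).filter fun A => ∃ z ∈ U, z ≠ p ∧ A ∈ edgeFamily F z).card
      ≤ 20 * U.card + 1 := by
  set B := (edgeFamily F p).filter fun A => ∃ z ∈ U, z ≠ p ∧ A ∈ edgeFamily F z with hB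
  by_contra! hcon
  have htr : trace B U = B := by
    refine (Finset.image_congr fun A hA => ?_).trans Finset.image_id
    exact Finset.inter_eq_left.2
      (hFU A (mem_edgeFamily.1 (Finset.mem_filter.1 (Finset.mem_coe.1 hA)).1).1)
  obtain ⟨V, -, hV, hdeg⟩ := exists_trace_edgeFamily_large B U 20 (by rwa [htr])
  refine hF.false_of_edgeFamily_large (Finset.filter_subset _ _) (fun A hA => ?_) hV hdeg
  obtain ⟨z, -, hzp, hz⟩ := (Finset.mem_filter.1 hA).2
  exact ⟨z, hzp, (mem_edgeFamily.1 hz).2⟩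

theorem VennFree.sum_card_edgeFamily_le {F : Finset (Finset α)} (hF : VennFree 5 F)
    {U : Finset α} (hFU : ∀ A ∈ F, A ⊆ U) :
    ∑ p ∈ U, (edgeFamily F p).card ≤ F.card + U.card * (20 * U.card + 1) := by
  have hsplit : ∀ p, (edgeFamily F p).card =
      ((edgeFamily F p).filter fun A => ¬ ∃ z ∈ U, z ≠ p ∧ A ∈ edgeFamily F z).card +
      ((edgeFamily F p).filter fun A => ∃ z ∈ U, z ≠ p ∧ A ∈ edgeFamily F z).card := fun p => by
    rw [add_comm, Finset.card_filter_add_card_filter_not]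
  simp_rw [hsplit]
  rw [Finset.sum_add_distrib]
  refine Nat.add_le_add ?_ ?_
  · rw [← Finset.card_biUnion]
    · refine Finset.card_le_card fun A hA => ?_
      obtain ⟨p, -, hp⟩ := Finset.mem_biUnion.1 hA
      exact (mem_edgeFamily.1 (Finset.mem_filter.1 hp).1).1
    · intro p hp p' hp' hne
      refine Finset.disjoint_left.2 fun A hA hA' => ?_
      rw [Finset.mem_filter] at hA hA'
      exact hA.2 ⟨p', hp', hne.symm, hA'.1⟩
  · rw [← smul_eq_mul]
    exact Finset.sum_le_card_nsmul _ _ _ fun p _ => hF.card_edgeFamily_repeated_le hFU p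

theorem VennFree.card_le {F : Finset (Finset α)} (hF : VennFree 5 F) {U : Finset α}
    (hFU : ∀ A ∈ F, A ⊆ U) : F.card ≤ 60 * U.card ^ 2 + 1 := by
  induction hn : U.card generalizing F U with
  | zero =>
    rw [Finset.card_eq_zero] at hn
    subst hn
    have : F ⊆ {∅} := fun A hA => by simpa using hFU A hA
    simpa using Finset.card_le_card this
  | succ m ih =>
    by_contra! hcon
    -- Trimming to exactly `60 * (m + 1) ^ 2 + 2` sets makes both sides of the degree count
    -- explicit.
    obtain ⟨F', hF'F, hcard⟩ := Finset.exists_subset_card_eq (Nat.succ_le_of_lt hcon)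
    have hF' := hF.mono hF'F
    have hF'U : ∀ A ∈ F', A ⊆ U := fun A hA => hFU A (hF'F hA)
    have hdeg : ∀ p ∈ U, 60 * (2 * m + 1) + 1 ≤ (edgeFamily F' p).card := by
      intro p hp
      have h1 := card_le_card_image_erase_add F' p
      have htr : F'.image (·.erase p) = trace F' (U.erase p) := by
        refine Finset.image_congr fun A hA => ?_
        simp only [Finset.inter_erase, Finset.inter_eq_left.2 (hF'U A hA)]
      have h2 : (trace F' (U.erase p)).card ≤ 60 * m ^ 2 + 1 := by
        refine ih (vennFree_trace hF' _) (U := U.erase p) (fun A hA => ?_) ?_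
        · obtain ⟨A, -, rfl⟩ := mem_trace.1 hA
          exact Finset.inter_subset_right
        · rw [Finset.card_erase_of_mem hp, hn]; rfl
      rw [htr, hcard] at h1
      have : (m + 1) ^ 2 = m ^ 2 + 2 * m + 1 := by ring
      omega
    have h1 := Finset.card_nsmul_le_sum U _ _ hdeg
    have h2 := hF'.sum_card_edgeFamily_le hF'U
    rw [hcard, hn] at h2
    rw [hn, smul_eq_mul] at h1
    -- The degree count gives no contradiction at `m = 0`, but there are then only two subsets.
    rcases Nat.eq_zero_or_pos m with rfl | hm
    · have h3 := Finset.card_le_card fun A hA => Finset.mem_powerset.2 (hFU A hA)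
      rw [Finset.card_powerset, hn] at h3
      omega
    · rw [Nat.succ_eq_add_one] at h2
      nlinarith [h1.trans h2]

end VennFamily

theorem mainTheorem2 :
    ∃ C : ℝ, 0 < C ∧
      ∀ n : ℕ, 1 ≤ n → ∀ F : Finset (Finset (Fin n)), C * (n : ℝ) ^ 2 ≤ (F.card : ℝ) →
        ∃ X ∈ F, ∃ Y ∈ F, ∃ Z ∈ F, 6 ≤ filledInnerRegions X Y Z := by
  -- `62 * n ^ 2` exceeds `60 * n ^ 2 + 1` for every `n ≥ 1`.
  refine ⟨62, by norm_num, fun n hn F hF => ?_⟩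
  by_contra! hcon
  have hfree : VennFamily.VennFree 5 F := fun X hX Y hY Z hZ =>
    (VennFamily.card_le_filledInnerRegions X Y Z).trans
      (Nat.le_of_lt_succ (hcon X hX Y hY Z hZ))
  have h := hfree.card_le (U := Finset.univ) fun A _ => Finset.subset_univ A
  rw [Finset.card_univ, Fintype.card_fin] at h
  have h' : 62 * n ^ 2 ≤ F.card := by exact_mod_cast hF
  nlinarith
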